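/- Let $\mathcal N_2$ denote the class of all groups that are nilpotent of class at most two, i.e. groups $K$ with $[[K,K],K]=\{e\}$. Let $G\in\mathcal N_2$ and let $H$ be a subgroup of $G$. The $\mathcal N_2$-dominion of $H$ in $G$ is the subgroup $$\mathrm{dom}_G^{\mathcal N_2}(H)=\{a\in G : \text{for every } K\in\mathcal N_2 \text{ and all homomorphisms } f,g\colon G\to K,\ \text{if } f|_H=g|_H \text{ then } f(a)=g(a)\},$$ which contains $H$. Then: 1. for every $d\in\mathrm{dom}_G^{\mathcal N_2}(H)$ there is an integer $n>0$ with $d^n\in H$; 2. $H$ is a normal subgroup of $\mathrm{dom}_G^{\mathcal N_2}(H)$; 3. if $G$ is finitely generated, then $H$ has finite index in $\mathrm{dom}_G^{\mathcal N_2}(H)$. -/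

import Mathlib

universe u

/-- A group `G` lies in the variety `𝒩_c` of nilpotent groups of class at most `c`:
the term `G_{c+1}` of the lower central series, where `G_1 = G` and `G_{i+1} = [G_i, G]`, is trivial.
Mathlib numbers the series from `0`, so that `G_{c+1}` is the term with index `c`. -/
def IsNilpotentOfClassLE (c : ℕ) (G : Type u) [Group G] : Prop :=
  Subgroup.lowerCentralSeries (⊤ : Subgroup G) c = ⊥

/-- The dominion of a subgroup `H` of `G` in a full subcategory of the category of groups, given by
the class `C` of its objects: the elements `a` of `G` such that any two homomorphisms from `G` to
a group in `C` which agree on `H` also agree at `a`. -/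
def dominion (C : (K : Type u) → [Group K] → Prop) {G : Type u} [Group G] (H : Subgroup G) :
    Subgroup G where
  carrier := {a | ∀ (K : Type u) [Group K], C K →
    ∀ f g : G →* K, (∀ h ∈ H, f h = g h) → f a = g a}
  one_mem' := by
    intro K _ _ f g _
    simp
  mul_mem' := by
    intro a b ha hb K _ hK f g hfg
    rw [map_mul, map_mul, ha K hK f g hfg, hb K hK f g hfg]
  inv_mem' := by
    intro a ha K _ hK f g hfg
    rw [map_inv, map_inv, ha K hK f g hfg]

/-!
The projection of `G` onto `G / H[G, G]` and the trivial homomorphism agree on `H`, so the dominion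
of `H` lies in `H[G, G]`. As `[G, G]` is central, normality is immediate, and both the torsion and
the finite index statement reduce to an element `c` of `[G, G]` in the dominion.

Suppose that no positive power of `c` lies in `H`. Since `ℚ` is injective there is a character `χ`
of the center with values in `ℚ` that kills the intersection of the center with `H` but not `c`. The
alternating form `ω(x, y) = χ([x, y])` vanishes on `H × H`, so divisibility yields a
bimultiplicative `B` with `B(x, h) = 1` for `h ∈ H` and `B(x, y) = B(y, x) ω(x, y)²`. The second
identity says that in the central extension of `G` by `ℚ` with cocycle `B` the commutator subgroup
is the graph of `χ²` on `[G, G]`; the extension therefore splits by a section `σ` which is `(h, 1)`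
on `H` and `(x, χ(x)²)` on `[G, G]`. In the class two extension of `G × Hom(G, ℚ)` by `ℚ` defined by
the evaluation cocycle, the homomorphisms `x ↦ ((x, 1), 1)` and `x ↦ ((x, B(·, x)), σ(x)₂)` agree on
`H` but not at `c`.
-/

open scoped commutatorElement IsMulCommutative

section Commutator

variable {G M N A : Type*} [Group G] [Group M] [Group N] [CommGroup A]

theorem commutatorElement_mem_commutator (x y : G) : ⁅x, y⁆ ∈ commutator G :=
  Subgroup.commutator_mem_commutator (Subgroup.mem_top x) (Subgroup.mem_top y)

theorem commutator_le_iff {K : Subgroup G} : commutator G ≤ K ↔ ∀ x y : G, ⁅x, y⁆ ∈ K := by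
  simp [commutator_def, Subgroup.commutator_le]

theorem isNilpotentOfClassLE_two_iff {G : Type u} [Group G] :
    IsNilpotentOfClassLE 2 G ↔ commutator G ≤ Subgroup.center G := by
  rw [IsNilpotentOfClassLE, Subgroup.lowerCentralSeries_succ,
    Subgroup.commutator_top_right_eq_bot_iff_le_center, Subgroup.top_lowerCentralSeries_one]

theorem commutator_prod_le_center (hM : commutator M ≤ Subgroup.center M) :
    commutator (M × A) ≤ Subgroup.center (M × A) := by
  refine commutator_le_iff.mpr fun x y => Subgroup.mem_center_iff.mpr fun z => Prod.ext ?_ ?_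
  · exact Subgroup.mem_center_iff.mp (hM (commutatorElement_mem_commutator x.1 y.1)) z.1
  · exact mul_comm _ _

/-- The commutator of a group of class at most two, as a bimultiplicative map to the center. -/
def commutatorPairing (hG : commutator G ≤ Subgroup.center G) :
    G →* G →* Subgroup.center G :=
  have central (x y z : G) : z * ⁅x, y⁆ = ⁅x, y⁆ * z :=
    Subgroup.mem_center_iff.mp (hG (commutatorElement_mem_commutator x y)) z
  MonoidHom.mk' (fun x => MonoidHom.mk'
      (fun y => ⟨⁅x, y⁆, hG (commutatorElement_mem_commutator x y)⟩) fun y z => Subtype.ext <| by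
        simp only [Subgroup.coe_mul]
        rw [commutatorElement_mul_right_eq_mul_conj, mul_assoc _ y, central, mul_assoc _ _ y⁻¹,
          mul_inv_cancel_right])
    fun x y => MonoidHom.ext fun z => Subtype.ext <| by
      simp only [MonoidHom.mk'_apply, MonoidHom.mul_apply, Subgroup.coe_mul]
      rw [commutatorElement_mul_left_eq_conj_mul, central y z x, mul_inv_cancel_right, central]

@[simp] theorem coe_commutatorPairing (hG : commutator G ≤ Subgroup.center G) (x y : G) :
    (commutatorPairing hG x y : G) = ⁅x, y⁆ := rfl

theorem apply_mem_of_closure_eq_top (β : M →* N →* A) {s : Set M} {t : Set N}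
    (hs : Subgroup.closure s = ⊤) (ht : Subgroup.closure t = ⊤) {K : Subgroup A}
    (hK : ∀ x ∈ s, ∀ y ∈ t, β x y ∈ K) (x : M) (y : N) : β x y ∈ K := by
  have left (x : M) (hx : x ∈ s) : (⊤ : Subgroup N) ≤ K.comap (β x) :=
    ht ▸ (Subgroup.closure_le _).mpr (hK x hx)
  have right : (⊤ : Subgroup M) ≤ K.comap (β.flip y) :=
    hs ▸ (Subgroup.closure_le _).mpr fun x hx => left x hx (Subgroup.mem_top y)
  exact right (Subgroup.mem_top x)

theorem commutator_fg_of_le_center (hG : commutator G ≤ Subgroup.center G) [hfg : Group.FG G] :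
    (commutator G).FG := by
  obtain ⟨S, hS, hfin⟩ := Group.fg_iff.mp hfg
  let T := Subgroup.closure (Set.image2 (fun x y => ⁅x, y⁆) S S)
  refine (Subgroup.fg_iff _).mpr ⟨Set.image2 (fun x y => ⁅x, y⁆) S S, le_antisymm ?_ ?_,
    hfin.image2 _ hfin⟩
  · rw [Subgroup.closure_le]
    rintro _ ⟨x, -, y, -, rfl⟩
    exact commutatorElement_mem_commutator x y
  · exact commutator_le_iff.mpr <| apply_mem_of_closure_eq_top (commutatorPairing hG) hS hS
      (K := T.subgroupOf _) fun x hx y hy => Subgroup.subset_closure ⟨x, hx, y, hy, rfl⟩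

end Commutator

section Extension

variable {G A B Z : Type*} [Group G] [CommGroup A] [CommGroup B] [CommGroup Z]

instance {A : Type*} [AddGroup A] [DivisibleBy A ℤ] : RootableBy (Multiplicative A) ℤ where
  root a n := .ofAdd (DivisibleBy.div a.toAdd n)
  root_zero a := congrArg Multiplicative.ofAdd (DivisibleBy.div_zero a.toAdd)
  root_cancel a hn := congrArg Multiplicative.ofAdd (DivisibleBy.div_cancel a.toAdd hn)

theorem exists_comp_eq_of_injective [RootableBy Z ℤ] {j : A →* B}
    (hj : Function.Injective j) (φ : A →* Z) : ∃ ψ : B →* Z, ψ.comp j = φ := by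
  let : DivisibleBy (Additive Z) ℤ :=
    { div z n := .ofMul (RootableBy.root z.toMul n)
      div_zero z := RootableBy.root_zero z.toMul
      div_cancel z hn := RootableBy.root_cancel z.toMul hn }
  obtain ⟨ψ, hψ⟩ := (Module.Baer.of_divisible (Additive Z)).extension_property_addMonoidHom
    (MonoidHom.toAdditive j) hj (MonoidHom.toAdditive φ)
  exact ⟨MonoidHom.toAdditive.symm ψ, congrArg MonoidHom.toAdditive.symm hψ⟩

theorem exists_comp_subtype_eq [RootableBy Z ℤ] {H : Subgroup G} (φ : H →* Z)
    (hφ : (commutator G).subgroupOf H ≤ φ.ker) :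
    ∃ ψ : G →* Z, ψ.comp H.subtype = φ := by
  let q := (Abelianization.of : G →* Abelianization G).subgroupMap H
  have hq : Function.Surjective q := MonoidHom.subgroupMap_surjective _ _
  have hker : q.ker ≤ φ.ker := fun h hh => by
    have of_h : Abelianization.of (h : G) = 1 := congrArg Subtype.val hh
    exact hφ ((QuotientGroup.eq_one_iff (h : G)).mp of_h)
  obtain ⟨ψ, hψ⟩ := exists_comp_eq_of_injective (Subgroup.subtype_injective _)
    (q.liftOfSurjective hq ⟨φ, hker⟩)
  refine ⟨ψ.comp Abelianization.of, MonoidHom.ext fun h => ?_⟩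
  exact (DFunLike.congr_fun hψ (q h)).trans
    (MonoidHom.liftOfRightInverse_comp_apply _ _ _ ⟨φ, hker⟩ h)

theorem exists_hom_rat_ne_one {N : Subgroup A} {c : A} (hc : ∀ n : ℕ, 0 < n → c ^ n ∉ N) :
    ∃ χ : A →* Multiplicative ℚ, N ≤ χ.ker ∧ χ c ≠ 1 := by
  let powers : Multiplicative ℤ →* A ⧸ N := zpowersHom _ (c : A ⧸ N)
  have powers_injective : Function.Injective powers := by
    refine (injective_zpow_iff_not_isOfFinOrder (x := (c : A ⧸ N))).mpr fun h => ?_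
    obtain ⟨n, hn, hcn⟩ := isOfFinOrder_iff_pow_eq_one.mp h
    exact hc n hn ((QuotientGroup.eq_one_iff (c ^ n)).mp hcn)
  obtain ⟨ψ, hψ⟩ := exists_comp_eq_of_injective powers_injective
    (AddMonoidHom.toMultiplicative (Int.castAddHom ℚ))
  refine ⟨ψ.comp (QuotientGroup.mk' N), fun x hx => ?_, fun h => ?_⟩
  · simp [MonoidHom.mem_ker, (QuotientGroup.eq_one_iff x).mpr hx]
  · have ψ_c : ψ (c : A ⧸ N) = .ofAdd 1 := by
      simpa [powers] using DFunLike.congr_fun hψ (.ofAdd 1)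
    exact one_ne_zero (congrArg Multiplicative.toAdd (ψ_c.symm.trans h))

/-- The group of homomorphisms from `G` to `Z` that are trivial on the subgroup `H`. -/
def homAnnihilator (H : Subgroup G) (Z : Type*) [CommGroup Z] : Subgroup (G →* Z) :=
  (MonoidHom.compHom' H.subtype).ker

theorem mem_homAnnihilator {H : Subgroup G} {φ : G →* Z} :
    φ ∈ homAnnihilator H Z ↔ ∀ h ∈ H, φ h = 1 := by
  simp [homAnnihilator, MonoidHom.mem_ker, DFunLike.ext_iff]

noncomputable instance (H : Subgroup G) [RootableBy Z ℤ] [IsMulTorsionFree Z] :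
    RootableBy (homAnnihilator H Z) ℤ :=
  rootableByOfPowLeftSurj _ _ fun {n} hn φ => by
    let e : Z ≃* Z := MulEquiv.ofBijective (zpowGroupHom n)
      ⟨zpow_left_injective hn, RootableBy.surjective_pow Z ℤ hn⟩
    refine ⟨⟨e.symm.toMonoidHom.comp φ, mem_homAnnihilator.mpr fun h hh => ?_⟩, ?_⟩
    · simp [mem_homAnnihilator.mp φ.2 h hh]
    · exact Subtype.ext (MonoidHom.ext fun x => e.apply_symm_apply (φ.1 x))

end Extension

theorem exists_skew_symmetrization_eq_sq {G Z : Type*} [Group G] [CommGroup Z] [RootableBy Z ℤ]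
    [IsMulTorsionFree Z] {H : Subgroup G} (ω : G →* G →* Z) (alternating : ∀ x y, ω x y * ω y x = 1)
    (isotropic : ∀ h ∈ H, ∀ h' ∈ H, ω h h' = 1) :
    ∃ B : G →* G →* Z, (∀ x y, B x y = B y x * ω x y ^ 2) ∧ ∀ h ∈ H, B.flip h = 1 := by
  -- `ω` on `H` has values in the divisible group of characters killing `H`, so it extends to `G`.
  let ω_H : H →* homAnnihilator H Z := (ω.comp H.subtype).codRestrict _ fun h =>
    mem_homAnnihilator.mpr (isotropic h h.2)
  have ω_H_commutator : (commutator G).subgroupOf H ≤ ω_H.ker := fun h hh =>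
    Subtype.ext (Abelianization.commutator_subset_ker ω hh)
  obtain ⟨β', hβ'⟩ := exists_comp_subtype_eq ω_H ω_H_commutator
  let β : G →* G →* Z := (homAnnihilator H Z).subtype.comp β'
  have β_left (h : G) (hh : h ∈ H) (x : G) : β h x = ω h x :=
    congrArg (fun φ : homAnnihilator H Z => (φ : G →* Z) x) (DFunLike.congr_fun hβ' ⟨h, hh⟩ :)
  have β_right (x h : G) (hh : h ∈ H) : β x h = 1 := mem_homAnnihilator.mp (β' x).2 h hh
  refine ⟨ω * β * β.flip, fun x y => ?_, fun h hh => MonoidHom.ext fun x => ?_⟩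
  · calc ω x y * β x y * β y x = (ω x y * ω y x) * (ω x y * β x y * β y x) := by
          rw [alternating, one_mul]
      _ = ω y x * β y x * β x y * ω x y ^ 2 := by rw [pow_two]; ac_rfl
  · simp [β_left h hh, β_right x h hh, alternating]

/-- The central extension of `Γ` by `Z` with the bimultiplicative cocycle `β`. -/
@[ext]
structure TwistedProduct {Γ Z : Type*} [Group Γ] [CommGroup Z] (β : Γ →* Γ →* Z) where
  fst : Γ
  snd : Z

namespace TwistedProduct

variable {Γ Z : Type*} [Group Γ] [CommGroup Z] {β : Γ →* Γ →* Z}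

instance : Mul (TwistedProduct β) := ⟨fun x y => ⟨x.fst * y.fst, x.snd * y.snd * β x.fst y.fst⟩⟩

instance : One (TwistedProduct β) := ⟨⟨1, 1⟩⟩

instance : Inv (TwistedProduct β) := ⟨fun x => ⟨x.fst⁻¹, x.snd⁻¹ * β x.fst x.fst⟩⟩

@[simp] theorem fst_mul (x y : TwistedProduct β) : (x * y).fst = x.fst * y.fst := rfl

@[simp] theorem snd_mul (x y : TwistedProduct β) :
    (x * y).snd = x.snd * y.snd * β x.fst y.fst := rfl

@[simp] theorem fst_one : (1 : TwistedProduct β).fst = 1 := rfl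

@[simp] theorem snd_one : (1 : TwistedProduct β).snd = 1 := rfl

@[simp] theorem fst_inv (x : TwistedProduct β) : x⁻¹.fst = x.fst⁻¹ := rfl

@[simp] theorem snd_inv (x : TwistedProduct β) : x⁻¹.snd = x.snd⁻¹ * β x.fst x.fst := rfl

instance : Group (TwistedProduct β) :=
  Group.ofLeftAxioms
    (fun x y z => by ext <;> simp [mul_assoc, mul_comm, mul_left_comm])
    (fun x => by ext <;> simp)
    (fun x => by ext <;> simp)

variable (β) in
/-- The projection of the central extension onto the quotient `Γ`. -/
def fstHom : TwistedProduct β →* Γ := MonoidHom.mk' fst fst_mul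

theorem fstHom_surjective : Function.Surjective (fstHom β) := fun x => ⟨⟨x, 1⟩, rfl⟩

theorem map_fstHom_commutator : (commutator (TwistedProduct β)).map (fstHom β) = commutator Γ := by
  rw [commutator_def, Subgroup.map_commutator, Subgroup.map_top_of_surjective _ fstHom_surjective,
    commutator_def]

theorem fst_commutatorElement (x y : TwistedProduct β) : ⁅x, y⁆.fst = ⁅x.fst, y.fst⁆ :=
  map_commutatorElement (fstHom β) x y

theorem snd_commutatorElement (x y : TwistedProduct β) :
    ⁅x, y⁆.snd = β x.fst y.fst / β y.fst x.fst := by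
  have left_eq_one : β ⁅x.fst, y.fst⁆ = 1 :=
    Abelianization.commutator_subset_ker β (commutatorElement_mem_commutator _ _)
  have h : (⁅x, y⁆ * (y * x)).snd = (x * y).snd := by simp [commutatorElement_def, mul_assoc]
  simp only [snd_mul, fst_commutatorElement, left_eq_one, MonoidHom.one_apply, mul_one] at h
  rw [eq_div_iff_mul_eq']
  apply mul_left_cancel (a := x.snd * y.snd)
  rw [← h, mul_comm x.snd]
  ac_rfl

theorem commutator_le_center (hΓ : commutator Γ ≤ Subgroup.center Γ) :
    commutator (TwistedProduct β) ≤ Subgroup.center (TwistedProduct β) := by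
  intro m hm
  have fst_mem : m.fst ∈ commutator Γ := map_fstHom_commutator (β := β) ▸ ⟨m, hm, rfl⟩
  have left : β m.fst = 1 := Abelianization.commutator_subset_ker β fst_mem
  have right (z : Γ) : β z m.fst = 1 := Abelianization.commutator_subset_ker (β z) fst_mem
  refine Subgroup.mem_center_iff.mpr fun z => TwistedProduct.ext ?_ ?_
  · exact Subgroup.mem_center_iff.mp (hΓ fst_mem) z.fst
  · simp [left, right, mul_comm]

theorem exists_section_of_retraction (ψ : TwistedProduct β →* Z) (hψ : ∀ z, ψ ⟨1, z⟩ = z) :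
    ∃ σ : Γ →* TwistedProduct β, (∀ x, (σ x).fst = x) ∧ ∀ m ∈ ψ.ker, σ m.fst = m := by
  have ψ_mk (x : Γ) (z : Z) : ψ ⟨x, z⟩ = z * ψ ⟨x, 1⟩ := by
    rw [show (⟨x, z⟩ : TwistedProduct β) = ⟨1, z⟩ * ⟨x, 1⟩ by ext <;> simp, map_mul, hψ]
  have mul_mk (x y : Γ) : (⟨x, 1⟩ * ⟨y, 1⟩ : TwistedProduct β) = ⟨x * y, β x y⟩ := by
    ext <;> simp
  refine ⟨MonoidHom.mk' (fun x => ⟨x, (ψ ⟨x, 1⟩)⁻¹⟩) fun x y => TwistedProduct.ext rfl ?_,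
    fun _ => rfl, fun m hm => TwistedProduct.ext rfl ?_⟩
  · have h := map_mul ψ ⟨x, 1⟩ ⟨y, 1⟩
    rw [mul_mk, ψ_mk] at h
    simp only [snd_mul, ← mul_inv, ← h]
    rw [mul_inv_rev, inv_mul_cancel_right]
  · exact (eq_inv_of_mul_eq_one_left ((ψ_mk m.fst m.snd).symm.trans hm)).symm

variable (β) in
/-- The graph of `i`, as a homomorphism: a bimultiplicative cocycle is trivial on commutators. -/
def commutatorGraph (i : commutator Γ →* Z) : commutator Γ →* TwistedProduct β :=
  MonoidHom.mk' (fun c => ⟨c, i c⟩) fun c d => by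
    have β_c : β c = 1 := Abelianization.commutator_subset_ker β c.2
    ext <;> simp [β_c]

theorem range_commutatorGraph {i : commutator Γ →* Z}
    (hi : ∀ x y, β x y = β y x * i ⟨⁅x, y⁆, commutatorElement_mem_commutator x y⟩) :
    (commutatorGraph β i).range = commutator (TwistedProduct β) := by
  have commutator_le : commutator (TwistedProduct β) ≤ (commutatorGraph β i).range := by
    refine commutator_le_iff.mpr fun x y =>
      ⟨⟨⁅x.fst, y.fst⁆, commutatorElement_mem_commutator _ _⟩, TwistedProduct.ext ?_ ?_⟩
    · exact (fst_commutatorElement x y).symm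
    · rw [snd_commutatorElement, hi, mul_div_cancel_left]
      rfl
  refine le_antisymm ?_ commutator_le
  rintro _ ⟨c, rfl⟩
  obtain ⟨m, hm, m_fst⟩ := map_fstHom_commutator (β := β).ge c.2
  obtain ⟨d, rfl⟩ := commutator_le hm
  rwa [← Subtype.ext (a1 := d) (a2 := c) m_fst]

theorem exists_section [RootableBy Z ℤ] {H : Subgroup Γ} (hβ : ∀ h ∈ H, β.flip h = 1)
    {i : commutator Γ →* Z}
    (hi : ∀ x y, β x y = β y x * i ⟨⁅x, y⁆, commutatorElement_mem_commutator x y⟩)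
    (hiH : H.subgroupOf (commutator Γ) ≤ i.ker) :
    ∃ σ : Γ →* TwistedProduct β, (∀ x, (σ x).fst = x) ∧ (∀ h ∈ H, σ h = ⟨h, 1⟩) ∧
      ∀ c : commutator Γ, σ c = ⟨c, i c⟩ := by
  let sndHom : H.comap (fstHom β) →* Z :=
    MonoidHom.mk' (fun m => m.1.snd) fun m n => by
      have β_n : β.flip n.1.fst = 1 := hβ _ n.2
      simpa using DFunLike.congr_fun β_n m.1.fst
  have sndHom_commutator :
      (commutator (TwistedProduct β)).subgroupOf (H.comap (fstHom β)) ≤ sndHom.ker := by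
    rintro ⟨m, m_fst⟩ hm
    obtain ⟨c, rfl⟩ := (range_commutatorGraph hi).ge hm
    exact hiH (x := c) m_fst
  obtain ⟨ψ, hψ⟩ := exists_comp_subtype_eq sndHom sndHom_commutator
  have ψ_apply (h : Γ) (hh : h ∈ H) (z : Z) : ψ ⟨h, z⟩ = z :=
    DFunLike.congr_fun hψ ⟨⟨h, z⟩, hh⟩
  obtain ⟨σ, σ_fst, σ_ker⟩ := exists_section_of_retraction ψ (ψ_apply 1 H.one_mem)
  refine ⟨σ, σ_fst, fun h hh => σ_ker _ (ψ_apply h hh 1), fun c => ?_⟩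
  exact σ_ker (commutatorGraph β i c)
    (Abelianization.commutator_subset_ker ψ ((range_commutatorGraph hi).le ⟨c, rfl⟩))

end TwistedProduct

section Dominion

variable {G : Type u} [Group G] {H : Subgroup G}

theorem le_dominion (C : (K : Type u) → [Group K] → Prop) (H : Subgroup G) : H ≤ dominion C H :=
  fun h hh _ _ _ _ _ hfg => hfg h hh

theorem dominion_le_of_normal {C : (K : Type u) → [Group K] → Prop} {N : Subgroup G} [N.Normal]
    (hHN : H ≤ N) (hC : C (G ⧸ N)) : dominion C H ≤ N := fun d hd =>
  (QuotientGroup.eq_one_iff d).mp <| hd _ hC (QuotientGroup.mk' N) 1 fun h hh =>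
    (QuotientGroup.eq_one_iff h).mpr (hHN hh)

theorem dominion_le_sup_commutator (H : Subgroup G) :
    dominion (IsNilpotentOfClassLE 2) H ≤ H ⊔ commutator G := by
  have : (H ⊔ commutator G).Normal := Subgroup.Normal.of_commutator_le _ le_sup_right
  have : IsMulCommutative (G ⧸ (H ⊔ commutator G)) :=
    Subgroup.Normal.quotient_commutative_iff_commutator_le.mpr le_sup_right
  exact dominion_le_of_normal le_sup_left <| isNilpotentOfClassLE_two_iff.mpr fun x _ =>
    Subgroup.mem_center_iff.mpr fun y => mul_comm' y x

/-- The evaluation pairing, as a bimultiplicative map on `G × Hom(G, Z)` in the first coordinate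
of the left argument and the second coordinate of the right one. -/
def evaluationCocycle (G Z : Type*) [Group G] [CommGroup Z] :
    G × (G →* Z) →* G × (G →* Z) →* Z :=
  (MonoidHom.eval.compl₂ (MonoidHom.snd G (G →* Z))).comp (MonoidHom.fst G (G →* Z))

@[simp] theorem evaluationCocycle_apply {G Z : Type*} [Group G] [CommGroup Z]
    (p q : G × (G →* Z)) : evaluationCocycle G Z p q = q.2 p.1 := rfl

theorem section_apply_of_mem_dominion {Z : Type} [CommGroup Z]
    (hG : commutator G ≤ Subgroup.center G) {B : G →* G →* Z} (hB : ∀ h ∈ H, B.flip h = 1)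
    {σ : G →* TwistedProduct B} (hσ : ∀ x, (σ x).fst = x) (hσH : ∀ h ∈ H, σ h = ⟨h, 1⟩)
    {d : G} (hd : d ∈ dominion (IsNilpotentOfClassLE 2) H) : σ d = ⟨d, 1⟩ := by
  let f : G →* TwistedProduct (evaluationCocycle G Z) :=
    MonoidHom.mk' (fun x => ⟨(x, 1), 1⟩) fun x y => by ext <;> simp
  let g : G →* TwistedProduct (evaluationCocycle G Z) :=
    MonoidHom.mk' (fun x => ⟨(x, B.flip x), (σ x).snd⟩) fun x y => by
      ext <;> simp [hσ]
  have class_two : IsNilpotentOfClassLE 2 (TwistedProduct (evaluationCocycle G Z)) :=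
    isNilpotentOfClassLE_two_iff.mpr
      (TwistedProduct.commutator_le_center (commutator_prod_le_center hG))
  have f_d : f d = g d := hd _ class_two f g fun h hh => by simp [f, g, hB h hh, hσH h hh]
  exact TwistedProduct.ext (hσ d) (congrArg TwistedProduct.snd f_d).symm

theorem character_eq_one_of_mem_dominion {Z : Type} [CommGroup Z] [RootableBy Z ℤ]
    [IsMulTorsionFree Z] (hG : commutator G ≤ Subgroup.center G)
    {χ : Subgroup.center G →* Z} (hχ : H.subgroupOf (Subgroup.center G) ≤ χ.ker) {c : G}
    (hc : c ∈ commutator G) (hd : c ∈ dominion (IsNilpotentOfClassLE 2) H) :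
    χ ⟨c, hG hc⟩ = 1 := by
  let ω : G →* G →* Z := (commutatorPairing hG).compr₂ χ
  have ω_alternating (x y : G) : ω x y * ω y x = 1 := by
    rw [← map_one χ]
    refine (map_mul χ _ _).symm.trans (congrArg χ (Subtype.ext ?_))
    rw [Subgroup.coe_mul, coe_commutatorPairing, coe_commutatorPairing, ← commutatorElement_inv x y,
      mul_inv_cancel, Subgroup.coe_one]
  have ω_isotropic (h : G) (hh : h ∈ H) (h' : G) (hh' : h' ∈ H) : ω h h' = 1 :=
    hχ (H.mul_mem (H.mul_mem (H.mul_mem hh hh') (H.inv_mem hh)) (H.inv_mem hh'))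
  obtain ⟨B, hB, B_H⟩ := exists_skew_symmetrization_eq_sq ω ω_alternating ω_isotropic
  let i : commutator G →* Z := (powMonoidHom 2).comp (χ.comp (Subgroup.inclusion hG))
  have i_H : H.subgroupOf (commutator G) ≤ i.ker := fun x hx => by
    have χ_x : χ (Subgroup.inclusion hG x) = 1 := hχ hx
    simp [i, MonoidHom.mem_ker, χ_x]
  obtain ⟨σ, σ_fst, σ_H, σ_commutator⟩ := TwistedProduct.exists_section B_H hB i_H
  have i_c : i ⟨c, hc⟩ = 1 := congrArg TwistedProduct.snd <|
    (σ_commutator ⟨c, hc⟩).symm.trans (section_apply_of_mem_dominion hG B_H σ_fst σ_H hd)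
  exact (pow_eq_one_iff_left two_ne_zero).mp i_c

theorem exists_pow_mem_of_mem_commutator_of_mem_dominion
    (hG : commutator G ≤ Subgroup.center G) {c : G} (hc : c ∈ commutator G)
    (hd : c ∈ dominion (IsNilpotentOfClassLE 2) H) : ∃ n : ℕ, 0 < n ∧ c ^ n ∈ H := by
  by_contra! no_pow
  obtain ⟨χ, χ_H, χ_c⟩ := exists_hom_rat_ne_one (N := H.subgroupOf (Subgroup.center G))
    (c := ⟨c, hG hc⟩) no_pow
  exact χ_c (character_eq_one_of_mem_dominion hG χ_H hc hd)

theorem exists_pow_mem_of_mem_dominion (hG : commutator G ≤ Subgroup.center G) {d : G}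
    (hd : d ∈ dominion (IsNilpotentOfClassLE 2) H) : ∃ n : ℕ, 0 < n ∧ d ^ n ∈ H := by
  obtain ⟨h, hh, c, hc, rfl⟩ :=
    Subgroup.mem_sup_of_normal_right.mp (dominion_le_sup_commutator H hd)
  have hcd : c ∈ dominion (IsNilpotentOfClassLE 2) H :=
    (Subgroup.mul_mem_cancel_left _ (le_dominion _ H hh)).mp hd
  obtain ⟨n, hn, hcn⟩ := exists_pow_mem_of_mem_commutator_of_mem_dominion hG hc hcd
  have commute : Commute h c := Subgroup.mem_center_iff.mp (hG hc) h
  exact ⟨n, hn, commute.mul_pow n ▸ H.mul_mem (H.pow_mem hh n) hcn⟩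

theorem dominion_le_normalizer (hG : commutator G ≤ Subgroup.center G) (H : Subgroup G) :
    dominion (IsNilpotentOfClassLE 2) H ≤ Subgroup.normalizer H :=
  (dominion_le_sup_commutator H).trans
    (sup_le Subgroup.le_normalizer (hG.trans (Subgroup.center_le_normalizer _)))

end Dominion

section FiniteIndex

theorem fg_of_commGroup {A : Type*} [CommGroup A] [Group.FG A] (E : Subgroup A) : E.FG := by
  have : Module.Finite ℤ (Additive A) := Module.Finite.iff_addGroup_fg.mpr inferInstance
  have h := IsNoetherian.noetherian (AddSubgroup.toIntSubmodule E.toAddSubgroup)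
  rw [Submodule.fg_iff_addSubgroup_fg, AddSubgroup.toIntSubmodule_toAddSubgroup] at h
  exact (Subgroup.fg_iff_add_fg E).mpr h

theorem finite_of_surjective_of_isMulTorsion {A Q : Type*} [CommGroup A] [Group.FG A] [Group Q]
    {φ : A →* Q} (hφ : Function.Surjective φ) (hQ : IsMulTorsion Q) : Finite Q := by
  let : CommGroup Q :=
    { (inferInstance : Group Q) with
      mul_comm := hφ.forall₂.mpr fun x y => by rw [← map_mul, mul_comm, map_mul] }
  have : Group.FG Q := Group.fg_of_surjective hφ
  exact CommGroup.finite_of_fg_isMulTorsion Q hQ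

theorem finiteIndex_subgroupOf_of_le_sup_commutator {G : Type*} [Group G] [Group.FG G]
    (hG : commutator G ≤ Subgroup.center G) {H D : Subgroup G} (hHD : H ≤ D)
    (hD : D ≤ H ⊔ commutator G) [(H.subgroupOf D).Normal]
    (torsion : ∀ d ∈ D, ∃ n : ℕ, 0 < n ∧ d ^ n ∈ H) : (H.subgroupOf D).FiniteIndex := by
  have : IsMulCommutative (commutator G) :=
    ⟨⟨fun x y => Subtype.ext (Subgroup.mem_center_iff.mp (hG y.2) x)⟩⟩
  have : Group.FG (commutator G) :=
    (Group.fg_iff_subgroup_fg _).mpr (commutator_fg_of_le_center hG)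
  have : Group.FG (D.subgroupOf (commutator G)) :=
    (Group.fg_iff_subgroup_fg _).mpr (fg_of_commGroup _)
  let φ : D.subgroupOf (commutator G) →* D ⧸ H.subgroupOf D :=
    (QuotientGroup.mk' _).comp ((commutator G).subtype.subgroupComap D)
  have φ_surjective : Function.Surjective φ := by
    refine QuotientGroup.mk_surjective.forall.mpr ?_
    rintro ⟨d, hd⟩
    obtain ⟨h, hh, c, hc, rfl⟩ := Subgroup.mem_sup_of_normal_right.mp (hD hd)
    have c_mem : c ∈ D := (Subgroup.mul_mem_cancel_left _ (hHD hh)).mp hd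
    refine ⟨⟨⟨c, hc⟩, c_mem⟩, QuotientGroup.eq.mpr ?_⟩
    have conj_eq : c⁻¹ * (h * c) = h := by
      rw [Subgroup.mem_center_iff.mp (hG hc) h, inv_mul_cancel_left]
    exact (congrArg (· ∈ H) conj_eq).mpr hh
  have quotient_torsion : IsMulTorsion (D ⧸ H.subgroupOf D) := by
    refine QuotientGroup.mk_surjective.forall.mpr fun d => ?_
    obtain ⟨n, hn, hdn⟩ := torsion d d.2
    exact isOfFinOrder_iff_pow_eq_one.mpr ⟨n, hn, (QuotientGroup.eq_one_iff (d ^ n)).mpr hdn⟩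
  have : Finite (D ⧸ H.subgroupOf D) :=
    finite_of_surjective_of_isMulTorsion φ_surjective quotient_torsion
  exact Subgroup.finiteIndex_of_finite_quotient

end FiniteIndex

theorem corollary3p33 (G : Type u) [Group G] (hG : IsNilpotentOfClassLE 2 G) (H : Subgroup G) :
    (∀ d ∈ dominion (IsNilpotentOfClassLE 2) H, ∃ n : ℕ, 0 < n ∧ d ^ n ∈ H) ∧
    H ≤ dominion (IsNilpotentOfClassLE 2) H ∧
    (H.subgroupOf (dominion (IsNilpotentOfClassLE 2) H)).Normal ∧
    (Group.FG G → (H.subgroupOf (dominion (IsNilpotentOfClassLE 2) H)).FiniteIndex) := by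
  rw [isNilpotentOfClassLE_two_iff] at hG
  have torsion : ∀ d ∈ dominion (IsNilpotentOfClassLE 2) H, ∃ n : ℕ, 0 < n ∧ d ^ n ∈ H :=
    fun _ => exists_pow_mem_of_mem_dominion hG
  have normal : (H.subgroupOf (dominion (IsNilpotentOfClassLE 2) H)).Normal :=
    Subgroup.normal_subgroupOf_of_le_normalizer (dominion_le_normalizer hG H)
  exact ⟨torsion, le_dominion _ H, normal, fun _ =>
    finiteIndex_subgroupOf_of_le_sup_commutator hG (le_dominion _ H)
      (dominion_le_sup_commutator H) torsion⟩
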